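/- **Setting.** A network $\mathcal N$ is a finite bipartite graph between sources $S_1,\dots,S_I$ and parties $A_1,\dots,A_J$; write $i\to j$ if $S_i$ is connected to $A_j$. $\mathcal N$ is an *Exclusive Common-Source* network if for every source $S_i$ there are parties $A_j\ne A_{j'}$ such that $S_i$ is the only source connected to both. $\mathcal N$ admits a *Perfect Fractional Independent Set* if there are weights $0<x_j<1$ with $\sum_{j:\,i\to j}x_j=1$ for every $i$. A *classical strategy* consists of independent sources, $S_i$ taking a value $s_i\in\mathcal S_i$ with (discrete) distribution $p_i$, and of output distributions $P(a_j\mid \{s_i: i\to j\})$ of the parties; its outcome distribution is $P(a_1,\dots,a_J)=\sum_{s}\prod_i p_i(s_i)\prod_j P(a_j\mid\{s_i:i\to j\})$. A (finite-dimensional) *quantum strategy* consists of unit vectors $|\psi_i\rangle\in\bigotimes_{j:\,i\to j}\mathcal H_{i,j}$ and projective measurements $\{\Pi_{a_j}\}$ on $\bigotimes_{i:\,i\to j}\mathcal H_{i,j}$; its outcome distribution is $P(a_1,\dots,a_J)=\mathrm{Tr}\big(\bigotimes_i|\psi_i\rangle\langle\psi_i|\cdot\bigotimes_j\Pi_{a_j}\big)$.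 Let $p_{\mathrm{color}}$ be a probability distribution on the colors $\{1,\dots,C\}$, and for each party fix $C$ distinct outputs, called "color match $c$". A classical strategy is *Color-Matching* with color distribution $p_{\mathrm{color}}$ if the source values can be colored so that the color of $s_i$ has distribution $p_{\mathrm{color}}$ for every $i$ and each $A_j$ outputs color match $c$ if and only if all sources connected to her take color $c$. A quantum strategy is *Color-Matching* with color distribution $p_{\mathrm{color}}$ if each $\mathcal H_{i,j}$ has an orthonormal basis of colored vectors such that each $|\psi_i\rangle$ is a superposition of product basis vectors all of whose factors have one and the same color, color $c$ having total weight $p_{\mathrm{color}}(c)$, and, for every $j$ and $c$, the projection of $A_j$ for the outcome "color match $c$" is the projection on the span of the product basis vectors all of whose factors have color $c$. A *Color-Matching distribution* is the outcome distribution of a classical or quantum Color-Matching strategy. **Theorem.** Let $\mathcal N$ be an Exclusive Common-Source network that admits a Perfect Fractional Independent Set, and let $P$ be a Color-Matching distribution on $\mathcal N$ with color distribution $p_{\mathrm{color}}$, where $p_{\mathrm{color}}(c)>0$ for all $c$. Then every classical strategy on $\mathcal N$ whose outcome distribution is $P$ is Color-Matching with color distribution $p_{\mathrm{color}}$. More precisely,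 let $g_j^{(c)}$ be the probability, given the values $\{s_i:i\to j\}$, that $A_j$ outputs color match $c$. There are functions $\phi_i^{(c)}:\mathcal S_i\to\{0,1\}$ such that, for source values of positive probability, (i) $g_j^{(c)}(\{s_i:i\to j\})=\prod_{i:\,i\to j}\phi_i^{(c)}(s_i)$ for all $j$ and $c$ (in particular $g_j^{(c)}\in\{0,1\}$); (ii) $\sum_{c}\phi_i^{(c)}(s_i)=1$ for all $i$ and $s_i$; (iii) $\mathbb E\big[\phi_i^{(c)}\big]=p_{\mathrm{color}}(c)$ for all $i$ and $c$. Moreover, the color distribution is unique: for any coloring of the source values of this strategy for which each $A_j$ outputs color match $c$ if and only if all sources connected to her take color $c$, the color of every source has distribution $p_{\mathrm{color}}$. -/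

import Mathlib

open scoped ENNReal

namespace NetCorr

universe u v w o

/-- A network: a bipartite graph between sources `i : I` and parties `j : J`;
`N.Conn i j` means that source `i` is connected to party `j`. -/
structure Network (I : Type u) (J : Type v) where
  Conn : I → J → Prop
  decConn : ∀ i j, Decidable (Conn i j)

attribute [instance] Network.decConn

namespace Network

variable {I : Type u} {J : Type v}

/-- Exclusive Common-Source network: every source `i` is the only common source of some two
distinct parties. (In particular no source is redundant.) -/
def IsECS (N : Network I J) : Prop :=
  ∀ i, ∃ j j', j ≠ j' ∧ N.Conn i j ∧ N.Conn i j' ∧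
    ∀ i', N.Conn i' j → N.Conn i' j' → i' = i

/-- The network admits a Perfect Fractional Independent Set. -/
def AdmitsPFIS [Fintype J] (N : Network I J) : Prop :=
  ∃ x : J → ℝ, (∀ j, 0 < x j ∧ x j < 1) ∧
    ∀ i, ∑ j : {j // N.Conn i j}, x j = 1

end Network

/-- A classical strategy: source `i` picks a value in `S i` with distribution `src i`; party `j`
receives the values of all sources connected to her and produces an output in `O j` according to
the conditional distribution `resp j`. -/
structure ClassicalStrategy {I : Type u} {J : Type v} (N : Network I J) (O : J → Type o) where
  S : I → Type w
  src : ∀ i, PMF (S i)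
  resp : ∀ j, (∀ i : {i // N.Conn i j}, S i) → PMF (O j)

namespace ClassicalStrategy

variable {I : Type u} {J : Type v} {N : Network I J} {O : J → Type o}

/-- `P(a) = ∑_s ∏_i p_i(s_i) ∏_j P(a_j | s_i : i → j)`. -/
noncomputable def outcomeProb [Fintype I] [Fintype J] (σ : ClassicalStrategy.{u, v, w, o} N O)
    (a : ∀ j, O j) : ℝ≥0∞ :=
  ∑' s : ∀ i, σ.S i, (∏ i, σ.src i (s i)) * ∏ j, σ.resp j (fun i => s i) (a j)

/-- The messages that party `j` may receive: every source value has positive probability. -/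
def Possible (σ : ClassicalStrategy.{u, v, w, o} N O) (j : J)
    (m : ∀ i : {i // N.Conn i j}, σ.S i) : Prop :=
  ∀ i : {i // N.Conn i j}, m i ∈ (σ.src i).support

open Classical in
/-- When the source values are coloured by `κ`, every party outputs the colour match `c`
(which is the output `label j c`) exactly when all sources connected to her take colour `c`. -/
def OutputsMatches (σ : ClassicalStrategy.{u, v, w, o} N O) {C : ℕ} (label : ∀ j, Fin C → O j)
    (κ : ∀ i, σ.S i → Fin C) : Prop :=
  ∀ j m, σ.Possible j m → ∀ c,
    σ.resp j m (label j c) = if ∀ i : {i // N.Conn i j}, κ i (m i) = c then 1 else 0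

/-- A classical Color-Matching strategy with colour distribution `p`: the values of each source
carry a colour of law `p`, and the parties output the colour matches. -/
def IsColorMatching (σ : ClassicalStrategy.{u, v, w, o} N O) {C : ℕ} (p : PMF (Fin C))
    (label : ∀ j, Fin C → O j) : Prop :=
  ∃ κ : ∀ i, σ.S i → Fin C, (∀ i, (σ.src i).map (κ i) = p) ∧ σ.OutputsMatches label κ

end ClassicalStrategy

/-- A (finite-dimensional) quantum strategy, in coordinates. The arrow `i → j` carries a Hilbert
space with orthonormal basis `B i j`; source `i` distributes the unit vector `ψ i` of the tensor
product of the spaces of its arrows; party `j` performs a projective measurement with outcomes in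
`O j` on the tensor product of the spaces of her arrows. -/
structure QuantumStrategy {I : Type u} {J : Type v} [Fintype I] [Fintype J] [DecidableEq I]
    [DecidableEq J] (N : Network I J) (O : J → Type o) where
  B : I → J → Type
  fintypeB : ∀ i j, Fintype (B i j)
  decEqB : ∀ i j, DecidableEq (B i j)
  ψ : ∀ i, (∀ j : {j // N.Conn i j}, B i j) → ℂ
  norm_ψ : ∀ i, ∑ x, ‖ψ i x‖ ^ 2 = 1
  meas : ∀ j, O j →
    Matrix (∀ i : {i // N.Conn i j}, B i j) (∀ i : {i // N.Conn i j}, B i j) ℂ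
  isStarProjection_meas : ∀ j a, IsStarProjection (meas j a)
  meas_orthogonal : ∀ j a b, a ≠ b → meas j a * meas j b = 0
  -- the projections sum to the identity; only finitely many can be nonzero
  sum_meas : ∀ j, ∃ A : Finset (O j), (∀ a ∉ A, meas j a = 0) ∧ ∑ a ∈ A, meas j a = 1

attribute [instance] QuantumStrategy.fintypeB QuantumStrategy.decEqB

namespace QuantumStrategy

variable {I : Type u} {J : Type v} [Fintype I] [Fintype J] [DecidableEq I] [DecidableEq J]
  {N : Network I J} {O : J → Type o}

/-- Index set of the product basis of the tensor product of the spaces of all arrows. -/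
abbrev Global (τ : QuantumStrategy N O) : Type _ :=
  ∀ i, ∀ j : {j // N.Conn i j}, τ.B i j

/-- The global state `⊗_i |ψ_i⟩⟨ψ_i|`. -/
noncomputable def state (τ : QuantumStrategy N O) : Matrix τ.Global τ.Global ℂ :=
  Matrix.of fun x y => ∏ i, τ.ψ i (x i) * star (τ.ψ i (y i))

/-- The global measurement operator `⊗_j Π_{a_j}`. -/
noncomputable def globalMeas (τ : QuantumStrategy N O) (a : ∀ j, O j) :
    Matrix τ.Global τ.Global ℂ :=
  Matrix.of fun x y =>
    ∏ j, τ.meas j (a j) (fun i => x i ⟨j, i.2⟩) (fun i => y i ⟨j, i.2⟩)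

/-- Born rule: `P(a) = Tr (⊗_i |ψ_i⟩⟨ψ_i| · ⊗_j Π_{a_j})`, a nonnegative real number. -/
noncomputable def outcomeProb (τ : QuantumStrategy N O) (a : ∀ j, O j) : ℝ≥0∞ :=
  ENNReal.ofReal (τ.state * τ.globalMeas a).trace.re

open Classical in
/-- A quantum Color-Matching strategy with colour distribution `p`: the basis vectors of every
arrow carry colours (and possibly additional information), every source distributes a superposition
of monochromatic vectors in which colour `c` has total weight `p c`, and the measurement of every
party contains, for each colour `c`, the projection on the vectors all of whose colours are `c`. -/
def IsColorMatching (τ : QuantumStrategy N O) {C : ℕ} (p : PMF (Fin C))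
    (label : ∀ j, Fin C → O j) : Prop :=
  ∃ κ : ∀ i j, τ.B i j → Fin C,
    (∀ i x, τ.ψ i x ≠ 0 → ∃ c, ∀ j : {j // N.Conn i j}, κ i j (x j) = c) ∧
    (∀ i c, ENNReal.ofReal
      (∑ x with ∀ j : {j // N.Conn i j}, κ i j (x j) = c, ‖τ.ψ i x‖ ^ 2) = p c) ∧
    (∀ j c, τ.meas j (label j c) =
      Matrix.diagonal fun x => if ∀ i : {i // N.Conn i j}, κ i j (x i) = c then 1 else 0)

end QuantumStrategy

/-- `P` is a Color-Matching distribution on `N` with colour distribution `p`, where `label j c` is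
the output of party `j` that announces colour match `c`: it is the outcome distribution of a
classical or of a quantum Color-Matching strategy. -/
def IsCMDistribution {I : Type u} {J : Type v} [Fintype I] [Fintype J] [DecidableEq I]
    [DecidableEq J] (N : Network I J) {O : J → Type o} {C : ℕ} (p : PMF (Fin C))
    (label : ∀ j, Fin C → O j) (P : (∀ j, O j) → ℝ≥0∞) : Prop :=
  (∃ τ : ClassicalStrategy.{u, v, w, o} N O, τ.IsColorMatching p label ∧ τ.outcomeProb = P) ∨
  (∃ τ : QuantumStrategy.{u, v, o} N O, τ.IsColorMatching p label ∧ τ.outcomeProb = P)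

end NetCorr

universe uu vv ww oo ss

/-! Fix a colour c and let f_j be the probability, given her messages, that party j announces match
c. As far as matches are concerned, every source of a Color-Matching strategy, classical or quantum,
behaves like an independent draw of a colour. Hence joint probabilities of matches are products over
sources (`matchProb`), and the given strategy inherits them (`HasMatchProbs`). In particular E ∏ f_j
= p(c)^|I|, while E f_j = p(c)^(deg j). Since the weights x_j sum to 1 around each source, ∏ (E
f_j)^(x_j) = p(c)^|I| too. As f_j ≤ f_j^(x_j), Finner's inequality E ∏ f_j^(x_j) ≤ ∏ (E f_j)^(x_j)
is saturated.

Saturation is rigid. By `eq_of_finner_bound_le`, a pointwise smaller family attaining the same bound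
must agree almost surely. Comparison with f_j^(1/x_j) shows f_j ∈ {0, 1}; comparison with a
restriction of f_j shows that each local match extends to a global one. Moreover Finner's inequality
is Hölder's, applied source by source, and equality in Hölder forces conditional expectations to
vanish for the same values of a source (`avg_zero_iff_of_finner_eq`). If i is the only common source
of j and j', averaging out the sources not connected to j keeps f_j but turns f_j' into a function
of s_i alone. So whether s_i permits a match does not depend on the other sources, and f_k is the
indicator of a box (`exists_box_of_finner`).

The sides of the box have probability p(c), by comparing the matches of j, of j', and of both. Sides
of distinct colours are disjoint, because j and j' never announce different matches. As ∑ p(c) = 1,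
they cover the support, and the colour of a value is the side containing it. -/

namespace NetCorr

/-! ### Products of infinite sums. -/

section TsumPi

theorem tsum_prod_pi_fin {n : ℕ} : ∀ {α : Fin n → Type*} (f : ∀ i, α i → ℝ≥0∞),
    ∑' a : ∀ i, α i, ∏ i, f i (a i) = ∏ i, ∑' x, f i x := by
  induction n with
  | zero => intro α f; simp
  | succ n ih =>
    intro α f
    rw [← (Fin.consEquiv α).tsum_eq, ENNReal.tsum_prod', Fin.prod_univ_succ, ← ih,
      ← ENNReal.tsum_mul_right]
    refine tsum_congr fun x => ?_
    rw [← ENNReal.tsum_mul_left]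
    refine tsum_congr fun t => ?_
    simp [Fin.prod_univ_succ, Fin.consEquiv]

/-- Distributivity of a finite product over infinite sums. -/
theorem tsum_prod_pi {ι : Type*} [Fintype ι] {α : ι → Type*} (f : ∀ i, α i → ℝ≥0∞) :
    ∑' a : ∀ i, α i, ∏ i, f i (a i) = ∏ i, ∑' x, f i x := by
  let e := Fintype.equivFin ι
  rw [← (Equiv.piCongrLeft α e.symm).tsum_eq, ← e.symm.prod_comp, ← tsum_prod_pi_fin]
  refine tsum_congr fun t => ?_
  rw [← e.symm.prod_comp]
  refine Finset.prod_congr rfl fun i _ => ?_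
  rw [Equiv.piCongrLeft_apply_apply]

end TsumPi

/-- The basic source of almost-sure equalities: a strict inequality at one point of positive weight
would make the finite sums differ. -/
theorem eq_of_tsum_mul_le {α : Type*} {w f g : α → ℝ≥0∞} (hfg : ∀ a, f a ≤ g a)
    (hw : ∀ a, w a ≠ ⊤) (hf : ∑' a, w a * f a ≠ ⊤) (h : ∑' a, w a * g a ≤ ∑' a, w a * f a)
    {a : α} (ha : w a ≠ 0) : f a = g a := by
  by_contra hne
  refine absurd h (not_le.2 (ENNReal.tsum_lt_tsum (i := a) hf (fun b => ?_) ?_))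
  · gcongr; exact hfg b
  · exact (ENNReal.mul_lt_mul_iff_right ha (hw a)).2 (lt_of_le_of_ne (hfg a) hne)

theorem prod_rpow_eq_rpow_sum {ι : Type*} {t : Finset ι} {x : ι → ℝ} (hx0 : ∀ k ∈ t, 0 ≤ x k)
    (a : ℝ≥0∞) : ∏ k ∈ t, a ^ x k = a ^ ∑ k ∈ t, x k := by
  classical
  induction t using Finset.induction_on with
  | empty => simp
  | insert k t hk ih =>
    rw [Finset.prod_insert hk, Finset.sum_insert hk,
      ENNReal.rpow_add_of_nonneg _ _ (hx0 k (Finset.mem_insert_self k t))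
        (Finset.sum_nonneg fun l hl => hx0 l (Finset.mem_insert_of_mem hl)),
      ih fun l hl => hx0 l (Finset.mem_insert_of_mem hl)]

/-! ### Hölder's inequality for a discrete distribution, with its equality case. -/

section Holder

variable {α ι : Type*} (p : PMF α) (t : Finset ι) {f : ι → α → ℝ≥0∞} {x : ι → ℝ}

/-- The exponents sum to 1, so the weight `p a` can be spread over the factors, which reduces the
claim to Hölder for counting measure. -/
theorem pmf_tsum_prod_rpow_le (hx : ∑ k ∈ t, x k = 1) (hx0 : ∀ k ∈ t, 0 ≤ x k) :
    ∑' a, p a * ∏ k ∈ t, f k a ^ x k ≤ ∏ k ∈ t, (∑' a, p a * f k a) ^ x k := by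
  let : MeasurableSpace α := ⊤
  have h := ENNReal.lintegral_prod_norm_pow_le (μ := MeasureTheory.Measure.count) t
    (f := fun k a => p a * f k a) (fun k _ => measurable_from_top.aemeasurable) hx hx0
  simp only [MeasureTheory.lintegral_count] at h
  refine le_trans (le_of_eq (tsum_congr fun a => ?_)) h
  have : p a = ∏ k ∈ t, p a ^ x k := by rw [prod_rpow_eq_rpow_sum hx0, hx, ENNReal.rpow_one]
  conv_lhs => rw [this]
  rw [← Finset.prod_mul_distrib]
  exact Finset.prod_congr rfl fun k hk => (ENNReal.mul_rpow_of_nonneg _ _ (hx0 k hk)).symm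

/-- Equality case of Hölder's inequality: the functions have the same zeros. -/
theorem pmf_zero_iff_of_prod_rpow_eq (hx : ∑ k ∈ t, x k = 1) (hx0 : ∀ k ∈ t, 0 < x k)
    (hf : ∀ k ∈ t, ∀ a, f k a ≤ 1) (hm : ∀ k ∈ t, ∑' a, p a * f k a ≠ 0)
    (h : ∑' a, p a * ∏ k ∈ t, f k a ^ x k = ∏ k ∈ t, (∑' a, p a * f k a) ^ x k)
    {a : α} (ha : p a ≠ 0) {j k : ι} (hj : j ∈ t) (hk : k ∈ t) : f j a = 0 ↔ f k a = 0 := by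
  set m : ι → ℝ≥0∞ := fun k => ∑' a, p a * f k a
  have hm1 : ∀ k ∈ t, m k ≠ ⊤ := fun k hk => by
    refine ne_top_of_le_ne_top ENNReal.one_ne_top ?_
    calc m k ≤ ∑' a, p a * 1 := ENNReal.tsum_le_tsum fun a => by gcongr; exact hf k hk a
      _ = 1 := by simp [p.tsum_coe]
  have hr : ∀ k ∈ t, ∀ a, f k a / m k ≠ ⊤ := fun k hk a =>
    ENNReal.div_ne_top (ne_top_of_le_ne_top ENNReal.one_ne_top (hf k hk a)) (hm k hk)
  have hreal : ∀ a, (∏ k ∈ t, (f k a / m k) ^ x k).toReal =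
      ∏ k ∈ t, (f k a / m k).toReal ^ x k := fun a => by
    rw [ENNReal.toReal_prod]
    exact Finset.prod_congr rfl fun k _ => (ENNReal.toReal_rpow _ _).symm
  have hreal' : ∀ a, (∑ k ∈ t, ENNReal.ofReal (x k) * (f k a / m k)).toReal =
      ∑ k ∈ t, x k * (f k a / m k).toReal := fun a => by
    rw [ENNReal.toReal_sum fun k hk => ENNReal.mul_ne_top ENNReal.ofReal_ne_top (hr k hk a)]
    refine Finset.sum_congr rfl fun k hk => ?_
    rw [ENNReal.toReal_mul, ENNReal.toReal_ofReal (hx0 k hk).le]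
  have hfin : ∀ a, ∏ k ∈ t, (f k a / m k) ^ x k ≠ ⊤ := fun a =>
    ENNReal.prod_ne_top fun k hk => ENNReal.rpow_ne_top_of_nonneg (hx0 k hk).le (hr k hk a)
  have hfin' : ∀ a, ∑ k ∈ t, ENNReal.ofReal (x k) * (f k a / m k) ≠ ⊤ := fun a =>
    ENNReal.sum_ne_top.2 fun k hk => ENNReal.mul_ne_top ENNReal.ofReal_ne_top (hr k hk a)
  -- Weighted AM-GM for the normalised functions. Both sides have mean 1 (`hL`, `hR`), so equality
  -- holds wherever `p a ≠ 0`, and there all normalised values coincide.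
  have hle : ∀ a, ∏ k ∈ t, (f k a / m k) ^ x k ≤ ∑ k ∈ t, ENNReal.ofReal (x k) * (f k a / m k) := by
    intro a
    rw [← ENNReal.toReal_le_toReal (hfin a) (hfin' a), hreal, hreal']
    exact Real.geom_mean_le_arith_mean_weighted t x _ (fun k hk => (hx0 k hk).le) hx
      fun k _ => ENNReal.toReal_nonneg
  have hL : ∑' a, p a * ∏ k ∈ t, (f k a / m k) ^ x k = 1 := by
    have hM0 : ∏ k ∈ t, m k ^ x k ≠ 0 := Finset.prod_ne_zero_iff.2 fun k hk => by
      exact (ENNReal.rpow_pos (pos_iff_ne_zero.2 (hm k hk)) (hm1 k hk)).ne'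
    have hMt : ∏ k ∈ t, m k ^ x k ≠ ⊤ := ENNReal.prod_ne_top fun k hk =>
      ENNReal.rpow_ne_top_of_nonneg (hx0 k hk).le (hm1 k hk)
    have : ∀ a, p a * ∏ k ∈ t, (f k a / m k) ^ x k =
        (p a * ∏ k ∈ t, f k a ^ x k) * (∏ k ∈ t, m k ^ x k)⁻¹ := fun a => by
      rw [mul_assoc, ← div_eq_mul_inv, ← ENNReal.prod_div_distrib_of_ne_top fun k hk =>
        ENNReal.rpow_ne_top_of_nonneg (hx0 k hk).le (hm1 k hk)]
      congr 1
      exact Finset.prod_congr rfl fun k hk => ENNReal.div_rpow_of_nonneg _ _ (hx0 k hk).le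
    simp_rw [this]
    rw [ENNReal.tsum_mul_right, h, ENNReal.mul_inv_cancel hM0 hMt]
  have hR : ∑' a, p a * ∑ k ∈ t, ENNReal.ofReal (x k) * (f k a / m k) = 1 := by
    simp_rw [Finset.mul_sum]
    rw [Summable.tsum_finsetSum (fun _ _ => ENNReal.summable)]
    have : ∀ k ∈ t, ∑' a, p a * (ENNReal.ofReal (x k) * (f k a / m k)) = ENNReal.ofReal (x k) := by
      intro k hk
      have : ∀ a, p a * (ENNReal.ofReal (x k) * (f k a / m k)) =
          (p a * f k a) * (ENNReal.ofReal (x k) * (m k)⁻¹) := fun a => by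
        rw [div_eq_mul_inv]; ring
      simp_rw [this]
      rw [ENNReal.tsum_mul_right, mul_left_comm, ENNReal.mul_inv_cancel (hm k hk) (hm1 k hk),
        mul_one]
    rw [Finset.sum_congr rfl this, ← ENNReal.ofReal_sum_of_nonneg fun k hk => (hx0 k hk).le, hx,
      ENNReal.ofReal_one]
  have heq := eq_of_tsum_mul_le hle p.apply_ne_top (by rw [hL]; exact ENNReal.one_ne_top)
    (by rw [hL, hR]) ha
  have heq' := congrArg ENNReal.toReal heq
  rw [hreal, hreal', Real.geom_mean_eq_arith_mean_weighted_iff_of_pos t x _ hx0 hx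
    fun k _ => ENNReal.toReal_nonneg] at heq'
  have := (ENNReal.toReal_eq_toReal_iff' (hr j hj a) (hr k hk a)).1 (heq' j hj k hk)
  have hz : ∀ k ∈ t, (f k a / m k = 0 ↔ f k a = 0) := fun k hk => by
    simp [ENNReal.div_eq_zero_iff, hm1 k hk]
  rw [← hz j hj, ← hz k hk, this]

end Holder

/-! ### Expectations and partial averages over independent sources. -/

section Averages

variable {I : Type*} [Fintype I] {S : I → Type*} (p : ∀ i, PMF (S i))

/-- The probability of a tuple of independent source values. -/
noncomputable def weight (s : ∀ i, S i) : ℝ≥0∞ := ∏ i, p i (s i)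

/-- Expectation over independent source values. -/
noncomputable def expect (f : (∀ i, S i) → ℝ≥0∞) : ℝ≥0∞ := ∑' s, weight p s * f s

theorem weight_ne_zero_iff {s : ∀ i, S i} : weight p s ≠ 0 ↔ ∀ i, p i (s i) ≠ 0 := by
  simp [weight, Finset.prod_eq_zero_iff]

theorem weight_ne_top (s : ∀ i, S i) : weight p s ≠ ⊤ :=
  ENNReal.prod_ne_top fun i _ => (p i).apply_ne_top _

theorem expect_prod (u : ∀ i, S i → ℝ≥0∞) :
    expect p (fun s => ∏ i, u i (s i)) = ∏ i, ∑' y, p i y * u i y := by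
  rw [← tsum_prod_pi]
  exact tsum_congr fun s => by rw [weight, Finset.prod_mul_distrib]

theorem expect_const (a : ℝ≥0∞) : expect p (fun _ => a) = a := by
  have h : ∑' s, weight p s = 1 := by
    simpa [expect, PMF.tsum_coe] using expect_prod p (fun _ _ => 1)
  rw [expect, ENNReal.tsum_mul_right, h, one_mul]

theorem expect_mono {f g : (∀ i, S i) → ℝ≥0∞} (h : ∀ s, f s ≤ g s) : expect p f ≤ expect p g :=
  ENNReal.tsum_le_tsum fun s => by gcongr; exact h s

theorem expect_le_one {f : (∀ i, S i) → ℝ≥0∞} (h : ∀ s, f s ≤ 1) : expect p f ≤ 1 :=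
  (expect_mono p h).trans (expect_const p 1).le

theorem expect_congr {f g : (∀ i, S i) → ℝ≥0∞} (h : ∀ s, weight p s ≠ 0 → f s = g s) :
    expect p f = expect p g :=
  tsum_congr fun s => by
    by_cases hs : weight p s = 0
    · simp [hs]
    · rw [h s hs]

theorem expect_eq_zero_iff {f : (∀ i, S i) → ℝ≥0∞} :
    expect p f = 0 ↔ ∀ s, weight p s ≠ 0 → f s = 0 := by
  simp only [expect, ENNReal.tsum_eq_zero, mul_eq_zero]
  exact forall_congr' fun s => by tauto

theorem eq_of_expect_le {f g : (∀ i, S i) → ℝ≥0∞} (hfg : ∀ s, f s ≤ g s) (hf : expect p f ≠ ⊤)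
    (h : expect p g ≤ expect p f) {s : ∀ i, S i} (hs : weight p s ≠ 0) : f s = g s :=
  eq_of_tsum_mul_le hfg (weight_ne_top p) hf h hs

variable [DecidableEq I]

/-- The function `f` with the values of the sources in `V` averaged out. -/
noncomputable def avg (V : Finset I) (f : (∀ i, S i) → ℝ≥0∞) (s : ∀ i, S i) : ℝ≥0∞ :=
  expect p fun t => f (V.piecewise t s)

theorem weight_update_ne_zero {s : ∀ i, S i} (hs : weight p s ≠ 0) {i : I} {y : S i}
    (hy : p i y ≠ 0) : weight p (Function.update s i y) ≠ 0 := by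
  rw [weight_ne_zero_iff] at hs ⊢
  intro l
  by_cases hl : l = i
  · subst hl; simpa using hy
  · simpa [hl] using hs l

/-- Exchange of the value of source `i` with an independent copy. -/
theorem tsum_expect_swap (i : I) (F : S i → (∀ i, S i) → ℝ≥0∞) :
    ∑' y, p i y * expect p (F y) =
      ∑' y, p i y * expect p fun t => F (t i) (Function.update t i y) := by
  have inv : Function.Involutive
      (fun q : S i × (∀ i, S i) => (q.2 i, Function.update q.2 i q.1)) := fun q => by simp
  simp only [expect, ← ENNReal.tsum_mul_left]
  rw [← ENNReal.tsum_prod, ← ENNReal.tsum_prod, ← inv.toPerm.tsum_eq]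
  refine tsum_congr fun q => ?_
  have hw : p i (q.2 i) * weight p (Function.update q.2 i q.1) = p i q.1 * weight p q.2 := by
    rw [weight, weight, ← Finset.mul_prod_erase _ _ (Finset.mem_univ i),
      ← Finset.mul_prod_erase _ (fun l => p l (q.2 l)) (Finset.mem_univ i),
      Function.update_self, mul_left_comm]
    congr 2
    refine Finset.prod_congr rfl fun l hl => ?_
    rw [Function.update_of_ne (Finset.ne_of_mem_erase hl)]
  simp only [Function.Involutive.coe_toPerm]
  rw [← mul_assoc, hw, mul_assoc]

theorem avg_empty (f : (∀ i, S i) → ℝ≥0∞) (s : ∀ i, S i) : avg p ∅ f s = f s := by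
  simp [avg, expect_const]

theorem avg_univ (f : (∀ i, S i) → ℝ≥0∞) (s : ∀ i, S i) : avg p Finset.univ f s = expect p f := by
  simp [avg]

/-- After exchanging `y` with coordinate `i` of the averaging tuple, that tuple supplies all of
`insert i V`, and the leftover `y` sums to 1. -/
theorem avg_insert {i : I} {V : Finset I} (hi : i ∉ V) (f : (∀ i, S i) → ℝ≥0∞) (s : ∀ i, S i) :
    avg p (insert i V) f s = ∑' y, p i y * avg p V f (Function.update s i y) := by
  simp only [avg]
  rw [tsum_expect_swap p i (fun y t => f (V.piecewise t (Function.update s i y)))]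
  have : ∀ (y : S i) (t : ∀ i, S i),
      V.piecewise (Function.update t i y) (Function.update s i (t i)) =
        (insert i V).piecewise t s := by
    intro y t
    funext l
    by_cases hl : l = i
    · subst hl; simp [hi]
    · by_cases hlV : l ∈ V <;> simp [hl, hlV, Finset.piecewise]
  simp only [this]
  rw [ENNReal.tsum_mul_right, PMF.tsum_coe, one_mul]

theorem expect_tsum_update (i : I) (f : (∀ i, S i) → ℝ≥0∞) :
    expect p (fun s => ∑' y, p i y * f (Function.update s i y)) = expect p f := by
  have h := tsum_expect_swap p i (fun _ t => f t)
  rw [ENNReal.tsum_mul_right, PMF.tsum_coe, one_mul] at h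
  rw [h]
  simp only [expect, ← ENNReal.tsum_mul_left]
  rw [ENNReal.tsum_comm]
  exact tsum_congr fun y => tsum_congr fun s => by ring

theorem expect_avg (V : Finset I) (f : (∀ i, S i) → ℝ≥0∞) : expect p (avg p V f) = expect p f := by
  induction V using Finset.induction_on with
  | empty => exact congrArg _ (funext fun s => avg_empty p f s)
  | insert i V hi ih =>
    rw [← ih, ← expect_tsum_update p i (avg p V f)]
    exact congrArg _ (funext fun s => avg_insert p hi f s)

theorem dependsOn_avg {f : (∀ i, S i) → ℝ≥0∞} {D : Set I} (hf : DependsOn f D) (V : Finset I) :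
    DependsOn (avg p V f) (D \ V) := by
  intro s s' h
  refine congrArg (expect p) (funext fun t => hf fun l hl => ?_)
  by_cases hlV : l ∈ V
  · simp [hlV]
  · simpa [hlV] using h l ⟨hl, by simpa using hlV⟩

theorem avg_le_one {f : (∀ i, S i) → ℝ≥0∞} (h : ∀ s, f s ≤ 1) (V : Finset I) (s : ∀ i, S i) :
    avg p V f s ≤ 1 :=
  expect_le_one p fun _ => h _

theorem avg_eq_zero_iff {f : (∀ i, S i) → ℝ≥0∞} {V : Finset I} {s : ∀ i, S i} :
    avg p V f s = 0 ↔ ∀ t, weight p t ≠ 0 → f (V.piecewise t s) = 0 :=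
  expect_eq_zero_iff p

end Averages

/-! ### Finner's inequality and its equality case. -/

section Finner

variable {I J : Type*} [Fintype J] {S : I → Type*} (p : ∀ i, PMF (S i)) {conn : I → J → Prop}
  {x : J → ℝ} {f : J → (∀ i, S i) → ℝ≥0∞}

theorem apply_update_of_dependsOn {D : Set I} {g : (∀ i, S i) → ℝ≥0∞} [DecidableEq I]
    (hg : DependsOn g D) {i : I} (hi : i ∉ D) (s : ∀ i, S i) (y : S i) :
    g (Function.update s i y) = g s :=
  hg fun l hl => Function.update_of_ne (by rintro rfl; exact hi hl) _ _

variable [DecidableEq I] [∀ i j, Decidable (conn i j)]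

theorem tsum_prod_rpow_split (hf : ∀ k, DependsOn (f k) {i | conn i k}) (i : I) (s : ∀ i, S i) :
    ∑' y, p i y * ∏ k, f k (Function.update s i y) ^ x k =
      (∑' y, p i y * ∏ k with conn i k, f k (Function.update s i y) ^ x k) *
        ∏ k with ¬ conn i k, f k s ^ x k := by
  rw [← ENNReal.tsum_mul_right]
  refine tsum_congr fun y => ?_
  rw [mul_assoc, ← Finset.prod_filter_mul_prod_filter_not Finset.univ (fun k => conn i k)]
  congr 2
  refine Finset.prod_congr rfl fun k hk => ?_
  rw [apply_update_of_dependsOn (hf k) (by simpa using hk)]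

theorem prod_tsum_rpow_split (hf : ∀ k, DependsOn (f k) {i | conn i k}) (i : I) (s : ∀ i, S i) :
    ∏ k, (∑' y, p i y * f k (Function.update s i y)) ^ x k =
      (∏ k with conn i k, (∑' y, p i y * f k (Function.update s i y)) ^ x k) *
        ∏ k with ¬ conn i k, f k s ^ x k := by
  rw [← Finset.prod_filter_mul_prod_filter_not Finset.univ (fun k => conn i k)]
  congr 1
  refine Finset.prod_congr rfl fun k hk => ?_
  simp only [apply_update_of_dependsOn (hf k) (show i ∉ {i | conn i k} by simpa using hk)]
  rw [ENNReal.tsum_mul_right, PMF.tsum_coe, one_mul]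

variable (hx0 : ∀ k, 0 < x k) (hx : ∀ i, ∑ k with conn i k, x k = 1)
  (hf : ∀ k, DependsOn (f k) {i | conn i k})
include hx0 hx hf

/-- Functions of parties not connected to `i` are constant in `y` and factor out; Hölder applies to
the others, whose exponents sum to 1. -/
theorem finner_step (i : I) (s : ∀ i, S i) :
    ∑' y, p i y * ∏ k, f k (Function.update s i y) ^ x k ≤
      ∏ k, (∑' y, p i y * f k (Function.update s i y)) ^ x k := by
  rw [tsum_prod_rpow_split p hf, prod_tsum_rpow_split p hf]
  gcongr
  exact pmf_tsum_prod_rpow_le (p i) _ (hx i) fun k _ => (hx0 k).le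

theorem zero_iff_of_finner_step_eq (hf1 : ∀ k s, f k s ≤ 1) {i : I} {s : ∀ i, S i}
    (hm : ∀ k, ∑' y, p i y * f k (Function.update s i y) ≠ 0)
    (h : ∑' y, p i y * ∏ k, f k (Function.update s i y) ^ x k =
      ∏ k, (∑' y, p i y * f k (Function.update s i y)) ^ x k)
    {y : S i} (hy : p i y ≠ 0) {j k : J} (hj : conn i j) (hk : conn i k) :
    f j (Function.update s i y) = 0 ↔ f k (Function.update s i y) = 0 := by
  rw [tsum_prod_rpow_split p hf, prod_tsum_rpow_split p hf, ENNReal.mul_left_inj] at h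
  · exact pmf_zero_iff_of_prod_rpow_eq (f := fun k y => f k (Function.update s i y)) (p i) _ (hx i)
      (fun k _ => hx0 k) (fun k _ y => hf1 k _) (fun k _ => hm k) h hy (by simpa using hj)
      (by simpa using hk)
  · refine Finset.prod_ne_zero_iff.2 fun k hk => ?_
    have hk0 : f k s ≠ 0 := fun h0 => hm k (by
      simp [apply_update_of_dependsOn (hf k) (show i ∉ {i | conn i k} by simpa using hk), h0])
    exact (ENNReal.rpow_pos (pos_iff_ne_zero.2 hk0)
      (ne_top_of_le_ne_top ENNReal.one_ne_top (hf1 k s))).ne'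
  · exact ENNReal.prod_ne_top fun k _ => ENNReal.rpow_ne_top_of_nonneg (hx0 k).le
      (ne_top_of_le_ne_top ENNReal.one_ne_top (hf1 k s))

variable [Fintype I]

/-- **Finner's inequality**, conditional on the sources outside `V`. -/
theorem avg_prod_rpow_le (V : Finset I) (s : ∀ i, S i) :
    avg p V (fun s => ∏ k, f k s ^ x k) s ≤ ∏ k, avg p V (f k) s ^ x k := by
  induction V using Finset.induction_on generalizing s with
  | empty => simp [avg_empty]
  | insert i V hi ih =>
    simp only [avg_insert p hi]
    calc _ ≤ ∑' y, p i y * ∏ k, avg p V (f k) (Function.update s i y) ^ x k :=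
          ENNReal.tsum_le_tsum fun y => by gcongr; exact ih _
      _ ≤ _ := finner_step p hx0 hx
          (fun k => (dependsOn_avg p (hf k) V).mono Set.sdiff_subset) i s

/-- **Finner's inequality**. -/
theorem expect_prod_rpow_le :
    expect p (fun s => ∏ k, f k s ^ x k) ≤ ∏ k, expect p (f k) ^ x k := by
  have ⟨s⟩ : Nonempty (∀ i, S i) := ⟨fun i => (p i).support_nonempty.some⟩
  simpa only [avg_univ] using avg_prod_rpow_le p hx0 hx hf Finset.univ s

/-- Equality case of Finner's inequality: the conditional expectations have the same zeros. -/
theorem avg_zero_iff_of_finner_eq (hf1 : ∀ k s, f k s ≤ 1)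
    (hE : ∏ k, expect p (f k) ^ x k ≤ expect p (fun s => ∏ k, f k s ^ x k)) {i : I} {V : Finset I}
    (hi : i ∉ V) {s : ∀ i, S i} (hs : weight p s ≠ 0) (hpos : ∀ k, avg p (insert i V) (f k) s ≠ 0)
    {y : S i} (hy : p i y ≠ 0) {j k : J} (hj : conn i j) (hk : conn i k) :
    avg p V (f j) (Function.update s i y) = 0 ↔ avg p V (f k) (Function.update s i y) = 0 := by
  have hdep : ∀ (W : Finset I) k, DependsOn (avg p W (f k)) {i | conn i k} := fun W k =>
    (dependsOn_avg p (hf k) W).mono Set.sdiff_subset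
  have hle : ∀ k s, avg p V (f k) s ≤ 1 := fun k s => avg_le_one p (hf1 k) V s
  refine zero_iff_of_finner_step_eq p hx0 hx (hdep V) hle (s := s)
    (fun k => by rw [← avg_insert p hi]; exact hpos k) ?_ hy hj hk
  -- Averaging over `V`, then over `i`, then over the rest loses nothing in total by `hE`; hence the
  -- single step at `i` is an equality almost surely.
  refine eq_of_expect_le p
    (f := fun s => ∑' y, p i y * ∏ k, avg p V (f k) (Function.update s i y) ^ x k)
    (g := fun s => ∏ k, (∑' y, p i y * avg p V (f k) (Function.update s i y)) ^ x k)
    (fun s => finner_step p hx0 hx (hdep V) i s) ?_ ?_ hs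
  · rw [expect_tsum_update p i (fun s => ∏ k, avg p V (f k) s ^ x k)]
    exact ne_top_of_le_ne_top ENNReal.one_ne_top (expect_le_one p fun s =>
      Finset.prod_le_one' fun k _ => ENNReal.rpow_le_one (hle k s) (hx0 k).le)
  · simp only [← avg_insert p hi]
    rw [expect_tsum_update p i (fun s => ∏ k, avg p V (f k) s ^ x k)]
    calc expect p (fun s => ∏ k, avg p (insert i V) (f k) s ^ x k)
        ≤ ∏ k, expect p (avg p (insert i V) (f k)) ^ x k :=
          expect_prod_rpow_le p hx0 hx (hdep _)
      _ = ∏ k, expect p (f k) ^ x k := by simp only [expect_avg]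
      _ ≤ expect p (fun s => ∏ k, f k s ^ x k) := hE
      _ = expect p (avg p V fun s => ∏ k, f k s ^ x k) := (expect_avg p V _).symm
      _ ≤ _ := expect_mono p fun s => avg_prod_rpow_le p hx0 hx hf V s

/-- A family that attains the bound of Finner's inequality for a larger family agrees with it. -/
theorem eq_of_finner_bound_le {g : J → (∀ i, S i) → ℝ≥0∞} (hfg : ∀ k s, f k s ≤ g k s)
    (hg1 : ∀ k s, g k s ≤ 1) (hg0 : ∀ k, expect p (g k) ≠ 0)
    (hE : ∏ k, expect p (g k) ^ x k ≤ expect p (fun s => ∏ k, f k s ^ x k))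
    (k : J) {s : ∀ i, S i} (hs : weight p s ≠ 0) : f k s = g k s := by
  have hfin : ∀ k, expect p (g k) ≠ ⊤ := fun k =>
    ne_top_of_le_ne_top ENNReal.one_ne_top (expect_le_one p (hg1 k))
  have hfin' : ∀ k, expect p (f k) ≠ ⊤ := fun k =>
    ne_top_of_le_ne_top (hfin k) (expect_mono p (hfg k))
  refine eq_of_expect_le p (hfg k) (hfin' k) ?_ hs
  -- A strict drop of one expectation would strictly lower the product of powers, since the other
  -- factors of the larger family are nonzero and finite.
  by_contra hlt
  rw [not_le] at hlt
  refine absurd (hE.trans (expect_prod_rpow_le p hx0 hx hf)) (not_le.2 ?_)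
  classical
  rw [← Finset.mul_prod_erase _ _ (Finset.mem_univ k),
    ← Finset.mul_prod_erase _ (fun k => expect p (g k) ^ x k) (Finset.mem_univ k)]
  have hle : ∏ l ∈ Finset.univ.erase k, expect p (f l) ^ x l ≤
      ∏ l ∈ Finset.univ.erase k, expect p (g l) ^ x l :=
    Finset.prod_le_prod' fun l _ => ENNReal.rpow_le_rpow (expect_mono p (hfg l)) (hx0 l).le
  refine (mul_le_mul_right hle _).trans_lt ?_
  refine ENNReal.mul_lt_mul_left ?_ ?_ (ENNReal.rpow_lt_rpow hlt (hx0 k))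
  · exact Finset.prod_ne_zero_iff.2 fun l _ =>
      (ENNReal.rpow_pos (pos_iff_ne_zero.2 (hg0 l)) (hfin l)).ne'
  · exact ENNReal.prod_ne_top fun l _ => ENNReal.rpow_ne_top_of_nonneg (hx0 l).le (hfin l)

end Finner

/-! ### Rigidity: families saturating Finner's inequality are indicators of boxes. -/

section Rigidity

variable {I J : Type*} [Fintype I] [DecidableEq I] [Fintype J] {S : I → Type*}
  (p : ∀ i, PMF (S i)) {conn : I → J → Prop} [∀ i j, Decidable (conn i j)] {x : J → ℝ}
  {f : J → (∀ i, S i) → ℝ≥0∞}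

theorem weight_piecewise_ne_zero {s t : ∀ i, S i} (hs : weight p s ≠ 0) (ht : weight p t ≠ 0)
    (V : Finset I) : weight p (V.piecewise s t) ≠ 0 := by
  rw [weight_ne_zero_iff] at *
  intro i
  by_cases hi : i ∈ V <;> simp [hi, hs i, ht i]

variable (hx0 : ∀ k, 0 < x k) (hx : ∀ i, ∑ k with conn i k, x k = 1)
  (hf : ∀ k, DependsOn (f k) {i | conn i k}) (hf1 : ∀ k s, f k s ≤ 1)
  (hf0 : ∀ k, expect p (f k) ≠ 0)
  (hE : ∏ k, expect p (f k) ^ x k ≤ expect p (fun s => ∏ k, f k s))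
include hx0 hx hf hf1 hf0 hE

/-- The family f_k^(1/x_k) ≤ f_k already attains the bound, because its x_k-th powers are the f_k.
So f_k^(1/x_k) = f_k with exponent greater than 1. -/
theorem eq_zero_or_one_of_finner (hx1 : ∀ k, x k < 1) (k : J) {s : ∀ i, S i}
    (hs : weight p s ≠ 0) : f k s = 0 ∨ f k s = 1 := by
  have hinv : ∀ k, 1 < (x k)⁻¹ := fun k => (one_lt_inv₀ (hx0 k)).2 (hx1 k)
  have key : f k s ^ (x k)⁻¹ = f k s := by
    refine eq_of_finner_bound_le p hx0 hx (f := fun k s => f k s ^ (x k)⁻¹)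
      (fun k s s' h => by simp only [hf k h]) (fun k s => ?_) hf1 hf0 ?_ k hs
    · simpa using ENNReal.rpow_le_rpow_of_exponent_ge (hf1 k s) (hinv k).le
    · refine hE.trans (expect_mono p fun s => le_of_eq ?_)
      refine Finset.prod_congr rfl fun k _ => ?_
      rw [← ENNReal.rpow_mul, inv_mul_cancel₀ (hx0 k).ne', ENNReal.rpow_one]
  by_contra! hcon
  have := ENNReal.rpow_lt_rpow_of_exponent_gt (pos_iff_ne_zero.2 hcon.1)
    (lt_of_le_of_ne (hf1 k s) hcon.2) (hinv k)
  rw [ENNReal.rpow_one] at this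
  exact this.ne key

/-- Setting f_k to 0 where no extension exists leaves the product of the family unchanged almost
surely, so the bound is still attained and nothing was removed. -/
theorem exists_extension_of_finner (h01 : ∀ k s, weight p s ≠ 0 → f k s = 0 ∨ f k s = 1)
    {k : J} {s : ∀ i, S i} (hs : weight p s ≠ 0) (hk : f k s ≠ 0) :
    ∃ t, weight p t ≠ 0 ∧ (∀ l, f l t = 1) ∧ ∀ i, conn i k → t i = s i := by
  classical
  by_contra hcon
  let g : J → (∀ i, S i) → ℝ≥0∞ := fun k s =>
    if ∃ t, weight p t ≠ 0 ∧ (∀ l, f l t = 1) ∧ ∀ i, conn i k → t i = s i then f k s else 0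
  have hgf : ∀ k s, g k s ≤ f k s := fun k s => by
    simp only [g]; split_ifs <;> simp
  have hg : ∀ k, DependsOn (g k) {i | conn i k} := fun k s s' h => by
    have : ∀ t : ∀ i, S i, (∀ i, conn i k → t i = s i) ↔ ∀ i, conn i k → t i = s' i := fun t =>
      forall₂_congr fun i hi => by rw [h i hi]
    simp only [g, this, hf k h]
  refine hk ?_
  rw [← eq_of_finner_bound_le p hx0 hx hg hgf hf1 hf0 ?_ k hs]
  · simp only [g, if_neg hcon]
  · refine hE.trans (ENNReal.tsum_le_tsum fun s => ?_)
    by_cases hs : weight p s = 0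
    · simp [hs]
    gcongr
    by_cases hall : ∀ l, f l s = 1
    · refine Finset.prod_le_prod' fun l _ => ?_
      have : g l s = 1 := by
        simp only [g]
        rw [if_pos ⟨s, hs, hall, fun _ _ => rfl⟩, hall]
      rw [this, hall, ENNReal.one_rpow]
    · push Not at hall
      obtain ⟨l, hl⟩ := hall
      beta_reduce
      rw [Finset.prod_eq_zero (Finset.mem_univ l) ((h01 l s hs).resolve_right hl)]
      exact zero_le

/-- **Rigidity in Finner's inequality** for networks with exclusive common sources: functions that
attain the bound are indicators of boxes. -/
theorem exists_box_of_finner (hx1 : ∀ k, x k < 1)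
    (hecs : ∀ i, ∃ j j', conn i j ∧ conn i j' ∧ ∀ i', conn i' j → conn i' j' → i' = i) :
    ∃ Φ : ∀ i, Set (S i), ∀ k s, weight p s ≠ 0 →
      (f k s = 0 ∨ f k s = 1) ∧ (f k s = 1 ↔ ∀ i, conn i k → s i ∈ Φ i) := by
  have h01 : ∀ k s, weight p s ≠ 0 → f k s = 0 ∨ f k s = 1 := fun k s hs =>
    eq_zero_or_one_of_finner p hx0 hx hf hf1 hf0 hE hx1 k hs
  have hE' : ∏ k, expect p (f k) ^ x k ≤ expect p (fun s => ∏ k, f k s ^ x k) := by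
    refine hE.trans (expect_mono p fun s => Finset.prod_le_prod' fun k _ => ?_)
    simpa using ENNReal.rpow_le_rpow_of_exponent_ge (hf1 k s) (hx1 k).le
  choose j j' hij hij' huniq using hecs
  let Φ : ∀ i, Set (S i) := fun i =>
    {y | ∃ t, weight p t ≠ 0 ∧ f (j' i) (Function.update t i y) ≠ 0}
  -- Around a global match no conditional expectation vanishes, as the equality case of Hölder
  -- requires.
  have hpos : ∀ {s : ∀ i, S i}, weight p s ≠ 0 → (∀ l, f l s = 1) → ∀ V k,
      avg p V (f k) s ≠ 0 := fun {s} hs hall V k h0 => by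
    have := (avg_eq_zero_iff p).1 h0 s hs
    rw [Finset.piecewise_same, hall] at this
    exact one_ne_zero this
  have swap : ∀ k s i (y : S i), weight p s ≠ 0 → f k s ≠ 0 → conn i k → p i y ≠ 0 →
      (f k (Function.update s i y) ≠ 0 ↔ y ∈ Φ i) := by
    intro k s i y hs hks hik hy
    obtain ⟨t, ht, hall, hts⟩ := exists_extension_of_finner p hx0 hx hf hf1 hf0 hE h01 hs hks
    have e1 : f k (Function.update s i y) = f k (Function.update t i y) := hf k fun l hl => by
      by_cases hli : l = i
      · subst hli; simp
      · simp [hli, hts l hl]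
    have e2 := avg_zero_iff_of_finner_eq p hx0 hx hf hf1 hE' (Finset.notMem_empty i) ht
      (hpos ht hall _) hy hik (hij i)
    simp only [avg_empty] at e2
    -- Averaging over `V` does nothing to the function of `j i`; it removes every source of `j' i`
    -- except `i`, the only common source.
    let V : Finset I := {l | ¬ conn l (j i)}
    have hiV : i ∉ V := by simp [V, hij i]
    have e3 := avg_zero_iff_of_finner_eq p hx0 hx hf hf1 hE' hiV ht (hpos ht hall _) hy
      (hij i) (hij' i)
    have e4 : avg p V (f (j i)) (Function.update t i y) = f (j i) (Function.update t i y) := by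
      rw [← expect_const p (f (j i) (Function.update t i y))]
      refine congrArg (expect p) (funext fun u => hf _ fun l hl => ?_)
      have : l ∉ V := by simpa [V] using hl
      simp [this]
    have e5 : avg p V (f (j' i)) (Function.update t i y) = 0 ↔ y ∉ Φ i := by
      simp only [avg_eq_zero_iff, Φ, Set.mem_ofPred_eq, not_exists, not_and, not_not]
      refine forall₂_congr fun u _ => ?_
      suffices h : f (j' i) (V.piecewise u (Function.update t i y)) =
          f (j' i) (Function.update u i y) by rw [h]
      refine hf _ fun l hl => ?_
      by_cases hli : l = i
      · subst hli; simp [hiV]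
      · have : l ∈ V := by simpa [V] using fun h => hli (huniq i l h hl)
        simp [this, hli]
    rw [e1, ne_eq, e2, ← e4, e3, e5, not_not]
  refine ⟨Φ, fun k s hs => ⟨h01 k s hs, ?_⟩⟩
  have hone : ∀ s, weight p s ≠ 0 → (f k s = 1 ↔ f k s ≠ 0) := fun s hs => by
    rcases h01 k s hs with h | h <;> simp [h]
  rw [hone s hs]
  constructor
  · intro h i hi
    have := swap k s i (s i) hs h hi ((weight_ne_zero_iff p).1 hs i)
    rwa [Function.update_eq_self, iff_true_left h] at this
  · intro hΦ
    obtain ⟨t, ht, hkt⟩ : ∃ t, weight p t ≠ 0 ∧ f k t ≠ 0 := by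
      by_contra! hcon
      exact hf0 k ((expect_eq_zero_iff p).2 hcon)
    -- Move from a match `t` to `s` one source at a time; `swap` keeps the value nonzero.
    have main : ∀ W : Finset I, f k (W.piecewise s t) ≠ 0 := by
      intro W
      induction W using Finset.induction_on with
      | empty => simpa using hkt
      | insert i W hi ih =>
        rw [Finset.piecewise_insert]
        by_cases hik : conn i k
        · exact (swap k _ i (s i) (weight_piecewise_ne_zero p hs ht W) ih hik
            ((weight_ne_zero_iff p).1 hs i)).2 (hΦ i hik)
        · rwa [apply_update_of_dependsOn (hf k) hik]
    simpa using main Finset.univ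

end Rigidity

/-! ### Match probabilities of classical strategies. -/

open Classical in
/-- The probability that the parties in `T` announce the outputs prescribed by `b`. -/
noncomputable def marginal {J : Type*} {O : J → Type*} (P : (∀ j, O j) → ℝ≥0∞) (T : Finset J)
    (b : ∀ j, O j) : ℝ≥0∞ :=
  ∑' a, if ∀ k ∈ T, a k = b k then P a else 0

open Classical in
/-- The probability that the parties in `T` announce the colour matches `c`, in terms of the colour
distribution: every source takes a colour that is admitted by all parties of `T` it reaches. -/
noncomputable def matchProb {I J : Type*} [Fintype I] (N : Network I J) {C : ℕ} (p : PMF (Fin C))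
    (T : Finset J) (c : J → Fin C) : ℝ≥0∞ :=
  ∏ i, ∑ d, if ∀ k ∈ T, N.Conn i k → d = c k then p d else 0

namespace ClassicalStrategy

variable {I J : Type*} [Fintype I] {N : Network I J} {O : J → Type*}
  (σ : ClassicalStrategy N O)

theorem possible_of_weight_ne_zero {s : ∀ i, σ.S i} (hs : weight σ.src s ≠ 0) (j : J) :
    σ.Possible j (fun i => s i) := fun i =>
  (PMF.mem_support_iff _ _).2 ((weight_ne_zero_iff σ.src).1 hs i)

theorem marginal_outcomeProb [Fintype J] (T : Finset J) (b : ∀ j, O j) :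
    marginal σ.outcomeProb T b =
      expect σ.src fun s => ∏ k ∈ T, σ.resp k (fun i => s i) (b k) := by
  classical
  have h1 : marginal σ.outcomeProb T b = ∑' a : ∀ j, O j, ∑' s : ∀ i, σ.S i, weight σ.src s *
      ∏ j, if j ∈ T → a j = b j then σ.resp j (fun i => s i) (a j) else 0 := by
    refine tsum_congr fun a => ?_
    rw [outcomeProb]
    by_cases ha : ∀ k ∈ T, a k = b k
    · rw [if_pos ha]
      refine tsum_congr fun s => congrArg _ (Finset.prod_congr rfl fun j _ => ?_)
      rw [if_pos (ha j)]
    · rw [if_neg ha]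
      push Not at ha
      obtain ⟨k, hk, hab⟩ := ha
      refine (ENNReal.tsum_eq_zero.2 fun s => ?_).symm
      rw [Finset.prod_eq_zero (Finset.mem_univ k), mul_zero]
      rw [if_neg fun h => hab (h hk)]
  rw [h1, ENNReal.tsum_comm]
  refine tsum_congr fun s => ?_
  rw [ENNReal.tsum_mul_left, tsum_prod_pi (fun j x =>
    if j ∈ T → x = b j then σ.resp j (fun i => s i) x else 0)]
  congr 1
  rw [← Finset.prod_subset (Finset.subset_univ T)]
  · refine Finset.prod_congr rfl fun k hk => ?_
    rw [tsum_eq_single (b k) fun x hx => if_neg fun h => hx (h hk), if_pos fun _ => rfl]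
  · intro k _ hk
    simp [hk, PMF.tsum_coe]

theorem marginal_eq_matchProb [Fintype J] {C : ℕ} {p : PMF (Fin C)} {label : ∀ j, Fin C → O j}
    (h : σ.IsColorMatching p label) (T : Finset J) (c : J → Fin C) :
    marginal σ.outcomeProb T (fun j => label j (c j)) = matchProb N p T c := by
  classical
  obtain ⟨κ, hlaw, hκ⟩ := h
  rw [marginal_outcomeProb]
  have h1 : ∀ s : ∀ i, σ.S i, weight σ.src s ≠ 0 →
      ∏ k ∈ T, σ.resp k (fun i => s i) (label k (c k)) =
        ∏ i, if ∀ k ∈ T, N.Conn i k → κ i (s i) = c k then 1 else 0 := by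
    intro s hs
    refine (Finset.prod_congr rfl fun k _ =>
      hκ k _ (σ.possible_of_weight_ne_zero hs k) (c k)).trans ?_
    simp only [Finset.prod_boole, Subtype.forall, Finset.mem_univ, true_imp_iff]
    congr 1
    exact propext ⟨fun h i k hk hi => h k hk i hi, fun h k hk i hi => h i k hk hi⟩
  rw [expect_congr σ.src h1, expect_prod σ.src (fun i y =>
    if ∀ k ∈ T, N.Conn i k → κ i y = c k then 1 else 0), matchProb]
  refine Finset.prod_congr rfl fun i _ => ?_
  have hlaw' : ∀ d, p d = ∑' y, if d = κ i y then σ.src i y else 0 := fun d => by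
    rw [← hlaw i, PMF.map_apply]
    exact tsum_congr fun y => by congr
  simp only [hlaw']
  have h2 : ∀ d : Fin C, (if ∀ k ∈ T, N.Conn i k → d = c k then
      ∑' y, (if d = κ i y then σ.src i y else 0) else 0) =
      ∑' y, if d = κ i y then (if ∀ k ∈ T, N.Conn i k → d = c k then σ.src i y else 0) else 0 := by
    intro d
    split_ifs <;> simp
  rw [Finset.sum_congr rfl fun d _ => h2 d,
    ← Summable.tsum_finsetSum (fun _ _ => ENNReal.summable)]
  refine tsum_congr fun y => ?_
  simp

end ClassicalStrategy

/-! ### Match probabilities of quantum strategies. -/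

namespace QuantumStrategy

variable {I J : Type*} [Fintype I] [Fintype J] [DecidableEq I] [DecidableEq J]
  {N : Network I J} {O : J → Type*} (τ : QuantumStrategy N O)

/-- Regrouping of the basis of all arrows, from sources to parties. -/
def regroup : τ.Global ≃ ∀ j, ∀ i : {i // N.Conn i j}, τ.B i j where
  toFun x j i := x i ⟨j, i.2⟩
  invFun w i j := w j ⟨i, j.2⟩
  left_inv _ := rfl
  right_inv _ := rfl

theorem globalMeas_apply (a : ∀ j, O j) (x y : τ.Global) :
    τ.globalMeas a x y = ∏ j, τ.meas j (a j) (τ.regroup x j) (τ.regroup y j) := rfl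

theorem globalMeas_mul_self (a : ∀ j, O j) : τ.globalMeas a * τ.globalMeas a = τ.globalMeas a := by
  ext x y
  simp only [Matrix.mul_apply, globalMeas_apply, ← Finset.prod_mul_distrib]
  rw [τ.regroup.sum_comp fun w => ∏ j, τ.meas j (a j) (τ.regroup x j) (w j) *
    τ.meas j (a j) (w j) (τ.regroup y j), ← Fintype.piFinset_univ]
  refine (Finset.prod_univ_sum (fun _ => Finset.univ) fun j w =>
    τ.meas j (a j) (τ.regroup x j) w * τ.meas j (a j) w (τ.regroup y j)).symm.trans ?_
  refine Finset.prod_congr rfl fun j _ => ?_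
  rw [← Matrix.mul_apply, (τ.isStarProjection_meas j (a j)).isIdempotentElem.eq]

theorem isHermitian_globalMeas (a : ∀ j, O j) : (τ.globalMeas a).IsHermitian := by
  ext x y
  simp only [Matrix.conjTranspose_apply, globalMeas_apply, star_prod]
  refine Finset.prod_congr rfl fun j _ => ?_
  rw [← Matrix.conjTranspose_apply, ← Matrix.star_eq_conjTranspose,
    (τ.isStarProjection_meas j (a j)).isSelfAdjoint.star_eq]

open scoped ComplexOrder in
theorem posSemidef_state : τ.state.PosSemidef := by
  have : τ.state = Matrix.vecMulVec (fun x => ∏ i, τ.ψ i (x i))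
      (star fun x => ∏ i, τ.ψ i (x i)) := by
    ext x y
    simp [state, Matrix.vecMulVec_apply, Finset.prod_mul_distrib]
  rw [this]
  exact Matrix.posSemidef_vecMulVec_self_star _

-- Needed because `ENNReal.ofReal` is additive only on nonnegative reals.
open scoped ComplexOrder in
theorem trace_nonneg (a : ∀ j, O j) : 0 ≤ (τ.state * τ.globalMeas a).trace.re := by
  have h : (τ.state * τ.globalMeas a).trace =
      ((τ.globalMeas a).conjTranspose * τ.state * τ.globalMeas a).trace := by
    rw [Matrix.trace_mul_cycle, (τ.isHermitian_globalMeas a).eq, τ.globalMeas_mul_self,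
      Matrix.trace_mul_comm]
  rw [h]
  exact (Complex.le_def.1
    (τ.posSemidef_state.conjTranspose_mul_mul_same (τ.globalMeas a)).trace_nonneg).1

theorem sum_globalMeas_apply (A : ∀ j, Finset (O j)) (x y : τ.Global) :
    (∑ a ∈ Fintype.piFinset A, τ.globalMeas a) x y =
      ∏ j, (∑ o ∈ A j, τ.meas j o) (τ.regroup x j) (τ.regroup y j) := by
  simp only [Matrix.sum_apply, globalMeas_apply, Finset.prod_univ_sum]

-- Outcomes of parties outside `T` sum to the identity, so the total operator is diagonal and the
-- trace sees only the squared amplitudes: a classical product distribution.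
open Classical in
theorem marginal_outcomeProb (T : Finset J) (b : ∀ j, O j) (D : ∀ j,
      (∀ i : {i // N.Conn i j}, τ.B i j) → ℝ)
    (hD : ∀ j ∈ T, τ.meas j (b j) = Matrix.diagonal fun x => (D j x : ℂ)) :
    marginal τ.outcomeProb T b = ENNReal.ofReal
      (∑ x : τ.Global, (∏ i, ‖τ.ψ i (x i)‖ ^ 2) * ∏ k ∈ T, D k (τ.regroup x k)) := by
  choose A hA0 hA1 using τ.sum_meas
  let A' : ∀ j, Finset (O j) := fun j => if j ∈ T then {b j} else A j
  have hT : ∀ a ∈ Fintype.piFinset A', ∀ k ∈ T, a k = b k := fun a ha k hk => by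
    have := Fintype.mem_piFinset.1 ha k
    simpa [A', hk] using this
  have hsum : (∑ a ∈ Fintype.piFinset A', τ.globalMeas a) =
      Matrix.diagonal fun x => ((∏ k ∈ T, D k (τ.regroup x k) : ℝ) : ℂ) := by
    have hj : ∀ j, ∑ o ∈ A' j, τ.meas j o =
        Matrix.diagonal fun x => if j ∈ T then (D j x : ℂ) else 1 := fun j => by
      by_cases hj : j ∈ T
      · simp [A', hj, hD j hj]
      · simp [A', hj, hA1]
    ext x y
    simp only [sum_globalMeas_apply, hj]
    by_cases hxy : x = y
    · subst hxy
      simp [Finset.prod_ite_mem]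
    · rw [Matrix.diagonal_apply_ne _ hxy]
      have : τ.regroup x ≠ τ.regroup y := τ.regroup.injective.ne hxy
      obtain ⟨j, hj⟩ := Function.ne_iff.1 this
      exact Finset.prod_eq_zero (Finset.mem_univ j) (Matrix.diagonal_apply_ne _ hj)
  calc marginal τ.outcomeProb T b
      = ∑ a ∈ Fintype.piFinset A', τ.outcomeProb a := by
        rw [marginal, tsum_eq_sum (s := Fintype.piFinset A')]
        · exact Finset.sum_congr rfl fun a ha => if_pos (hT a ha)
        · intro a ha
          split_ifs with hab
          · simp only [Fintype.mem_piFinset, not_forall] at ha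
            obtain ⟨j, hj⟩ := ha
            have hjT : j ∉ T := fun hjT => hj (by simp [A', hjT, hab j hjT])
            have h0 : τ.globalMeas a = 0 := by
              ext x y
              rw [globalMeas_apply]
              refine Finset.prod_eq_zero (Finset.mem_univ j) ?_
              rw [hA0 j (a j) (by simpa [A', hjT] using hj)]
              rfl
            simp [outcomeProb, h0]
          · rfl
    _ = ENNReal.ofReal (τ.state * ∑ a ∈ Fintype.piFinset A', τ.globalMeas a).trace.re := by
        simp only [outcomeProb]
        rw [← ENNReal.ofReal_sum_of_nonneg fun a _ => τ.trace_nonneg a, Finset.mul_sum,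
          Matrix.trace_sum, Complex.re_sum]
    _ = _ := by
        rw [hsum]
        congr 1
        simp only [Matrix.trace, Matrix.diag_apply, Matrix.mul_diagonal, Complex.re_sum]
        refine Finset.sum_congr rfl fun x _ => ?_
        have : τ.state x x = ((∏ i, ‖τ.ψ i (x i)‖ ^ 2 : ℝ) : ℂ) := by
          simp only [state, Matrix.of_apply, Complex.ofReal_prod]
          refine Finset.prod_congr rfl fun i _ => ?_
          rw [Complex.star_def, Complex.mul_conj, Complex.normSq_eq_norm_sq]
        rw [this, ← Complex.ofReal_mul, Complex.ofReal_re]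

theorem marginal_eq_matchProb (hconn : ∀ i, ∃ j, N.Conn i j) {C : ℕ} {p : PMF (Fin C)}
    {label : ∀ j, Fin C → O j} (h : τ.IsColorMatching p label) (T : Finset J) (c : J → Fin C) :
    marginal τ.outcomeProb T (fun j => label j (c j)) = matchProb N p T c := by
  classical
  obtain ⟨κ, hmono, hlaw, hmeas⟩ := h
  rw [τ.marginal_outcomeProb T _ (fun j x => if ∀ i : {i // N.Conn i j}, κ i j (x i) = c j
    then 1 else 0) fun j _ => by rw [hmeas]; congr 1; funext x; split_ifs <;> simp]
  have h1 : ∀ x : τ.Global, (∏ i, ‖τ.ψ i (x i)‖ ^ 2) * (∏ k ∈ T,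
      if ∀ i : {i // N.Conn i k}, κ i k (τ.regroup x k i) = c k then (1 : ℝ) else 0) =
      ∏ i, ‖τ.ψ i (x i)‖ ^ 2 *
        if ∀ k : {k // N.Conn i k}, k.1 ∈ T → κ i k (x i k) = c k then 1 else 0 := by
    intro x
    rw [Finset.prod_mul_distrib, Finset.prod_ite_zero, Finset.prod_ite_zero]
    congr 1
    simp only [Finset.prod_const_one, Subtype.forall, Finset.mem_univ, true_imp_iff]
    congr 1
    exact propext ⟨fun h i k hi hk => h k hk i hi, fun h k hk i hi => h i k hi hk⟩
  rw [Finset.sum_congr rfl fun x _ => h1 x, ← Fintype.piFinset_univ,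
    ← Finset.prod_univ_sum (fun _ => Finset.univ) (fun i y => ‖τ.ψ i y‖ ^ 2 *
        if ∀ k : {k // N.Conn i k}, k.1 ∈ T → κ i k (y k) = c k then 1 else 0),
    ENNReal.ofReal_prod_of_nonneg fun i _ => Finset.sum_nonneg fun y _ => by positivity, matchProb]
  refine Finset.prod_congr rfl fun i _ => ?_
  have h2 : ∀ d : Fin C, (if ∀ k ∈ T, N.Conn i k → d = c k then p d else 0) = ENNReal.ofReal
      (∑ y, if ∀ j : {j // N.Conn i j}, κ i j (y j) = d then
        (if ∀ k ∈ T, N.Conn i k → d = c k then ‖τ.ψ i y‖ ^ 2 else 0) else 0) := by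
    intro d
    rw [← hlaw i d, Finset.sum_filter]
    split_ifs <;> simp
  refine Eq.trans ?_ (Finset.sum_congr rfl fun d _ => Eq.trans (h2 d).symm (by congr))
  rw [← ENNReal.ofReal_sum_of_nonneg
    fun d _ => Finset.sum_nonneg fun y _ => by positivity, Finset.sum_comm]
  congr 1
  refine Finset.sum_congr rfl fun y _ => ?_
  by_cases hy : τ.ψ i y = 0
  · simp [hy]
  obtain ⟨d₀, hd₀⟩ := hmono i y hy
  obtain ⟨j, hj⟩ := hconn i
  -- An arrow at `i` is needed here: without one, every colour would hold vacuously.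
  have h3 : ∀ d, (∀ j : {j // N.Conn i j}, κ i j (y j) = d) ↔ d = d₀ := fun d =>
    ⟨fun h => (h ⟨j, hj⟩).symm.trans (hd₀ ⟨j, hj⟩), fun h => h ▸ hd₀⟩
  have h4 : (∀ k : {k // N.Conn i k}, k.1 ∈ T → κ i k (y k) = c k) ↔
      ∀ k ∈ T, N.Conn i k → d₀ = c k :=
    ⟨fun h k hk hi => (hd₀ ⟨k, hi⟩).symm.trans (h ⟨k, hi⟩ hk),
      fun h k hk => (hd₀ k).trans (h k hk k.2)⟩
  simp only [h3, h4]
  simp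

end QuantumStrategy

theorem IsCMDistribution.marginal_eq_matchProb {I J : Type*} [Fintype I] [Fintype J]
    [DecidableEq I] [DecidableEq J] {N : Network I J} (hconn : ∀ i, ∃ j, N.Conn i j)
    {O : J → Type*} {C : ℕ} {p : PMF (Fin C)} {label : ∀ j, Fin C → O j}
    {P : (∀ j, O j) → ℝ≥0∞} (h : IsCMDistribution N p label P) (T : Finset J) (c : J → Fin C) :
    marginal P T (fun j => label j (c j)) = matchProb N p T c := by
  rcases h with ⟨τ, hτ, rfl⟩ | ⟨τ, hτ, rfl⟩
  · exact τ.marginal_eq_matchProb hτ T c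
  · exact τ.marginal_eq_matchProb hconn hτ T c

/-! ### Recovering single-source probabilities from match probabilities. -/

section MatchProb

variable {I J : Type*} [Fintype I] {N : Network I J} {C : ℕ} (p : PMF (Fin C))

open Classical in
/-- The product of the numbers `q i` over the sources `i` connected to a party in `T`. -/
noncomputable def reachedProd (N : Network I J) (T : Finset J) (q : I → ℝ≥0∞) : ℝ≥0∞ :=
  ∏ i, if ∃ k ∈ T, N.Conn i k then q i else 1

theorem matchProb_const (T : Finset J) (c : Fin C) :
    matchProb N p T (fun _ => c) = reachedProd N T fun _ => p c := by
  classical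
  refine Finset.prod_congr rfl fun i _ => ?_
  split_ifs with h
  · obtain ⟨k, hk, hi⟩ := h
    rw [Finset.sum_eq_single c]
    · rw [if_pos fun _ _ _ => rfl]
    · intro d _ hd
      exact if_neg fun h => hd (h k hk hi)
    · simp
  · push Not at h
    rw [← p.tsum_coe, tsum_fintype]
    exact Finset.sum_congr rfl fun d _ => if_pos fun k hk hi => absurd hi (h k hk)

theorem matchProb_eq_zero {T : Finset J} {c : J → Fin C} {i : I} {j j' : J} (hj : j ∈ T)
    (hj' : j' ∈ T) (hi : N.Conn i j) (hi' : N.Conn i j') (hc : c j ≠ c j') :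
    matchProb N p T c = 0 := by
  refine Finset.prod_eq_zero (Finset.mem_univ i) (Finset.sum_eq_zero fun d _ => if_neg fun h => ?_)
  exact hc ((h j hj hi).symm.trans (h j' hj' hi'))

/-- Inclusion-exclusion: only the exclusive common source is counted twice. -/
theorem reachedProd_singleton_mul [DecidableEq J] {i : I} {j j' : J} (hj : N.Conn i j)
    (hj' : N.Conn i j') (h : ∀ i', N.Conn i' j → N.Conn i' j' → i' = i) (q : I → ℝ≥0∞) :
    reachedProd N {j} q * reachedProd N {j'} q = reachedProd N {j, j'} q * q i := by
  classical
  have : q i = ∏ l, if l = i then q l else 1 := by simp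
  rw [this]
  simp only [reachedProd]
  rw [← Finset.prod_mul_distrib, ← Finset.prod_mul_distrib]
  refine Finset.prod_congr rfl fun l _ => ?_
  by_cases hl : l = i
  · subst hl; simp [hj, hj']
  · by_cases h1 : N.Conn l j
    · have h2 : ¬ N.Conn l j' := fun h2 => hl (h l h1 h2)
      simp [h1, h2, hl]
    · simp [h1, hl]

theorem eq_of_reachedProd_eq (hecs : N.IsECS) {q : I → ℝ≥0∞} {r : ℝ≥0∞} (hr0 : r ≠ 0)
    (hr : r ≠ ⊤) (h : ∀ T, reachedProd N T q = reachedProd N T fun _ => r) (i : I) : q i = r := by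
  classical
  obtain ⟨j, j', -, hj, hj', huniq⟩ := hecs i
  have h1 := reachedProd_singleton_mul hj hj' huniq q
  rw [h, h, h, reachedProd_singleton_mul hj hj' huniq] at h1
  refine ((ENNReal.mul_right_inj ?_ ?_).1 h1).symm
  · refine Finset.prod_ne_zero_iff.2 fun l _ => ?_
    split_ifs <;> simp [hr0]
  · refine ENNReal.prod_ne_top fun l _ => ?_
    split_ifs <;> simp [hr]

end MatchProb

/-! ### From boxes to colours. -/

namespace ClassicalStrategy

variable {I J : Type*} [Fintype I] {N : Network I J} {O : J → Type*}
  (σ : ClassicalStrategy N O)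

theorem Possible.exists_extension {σ : ClassicalStrategy N O} {j : J}
    {m : ∀ i : {i // N.Conn i j}, σ.S i} (hm : σ.Possible j m) :
    ∃ s : ∀ i, σ.S i, weight σ.src s ≠ 0 ∧ (fun i : {i // N.Conn i j} => s i) = m := by
  refine ⟨fun i => if h : N.Conn i j then m ⟨i, h⟩ else (σ.src i).support_nonempty.some,
    (weight_ne_zero_iff _).2 fun i => ?_, funext fun i => dif_pos i.2⟩
  split_ifs with h
  · exact (PMF.mem_support_iff _ _).1 (hm ⟨i, h⟩)
  · exact (PMF.mem_support_iff _ _).1 (σ.src i).support_nonempty.some_mem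

variable {C : ℕ} {p : PMF (Fin C)} {label : ∀ j, Fin C → O j}

/-- All parties of `T` announce their colour matches with the probabilities of a strategy with
colour distribution `p`. -/
def HasMatchProbs (p : PMF (Fin C)) (label : ∀ j, Fin C → O j) : Prop :=
  ∀ (T : Finset J) (c : J → Fin C),
    expect σ.src (fun s => ∏ k ∈ T, σ.resp k (fun i => s i) (label k (c k))) = matchProb N p T c

/-- Colour match `c` is announced exactly when all source values lie in the sets `Φ i`. -/
def MatchesBox (o : ∀ j, O j) (Φ : ∀ i, Set (σ.S i)) : Prop :=
  ∀ k s, weight σ.src s ≠ 0 →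
    (σ.resp k (fun i => s i) (o k) = 0 ∨ σ.resp k (fun i => s i) (o k) = 1) ∧
    (σ.resp k (fun i => s i) (o k) = 1 ↔ ∀ i, N.Conn i k → s i ∈ Φ i)

variable {σ}

open Classical in
theorem MatchesBox.resp_eq {o : ∀ j, O j} {Φ : ∀ i, Set (σ.S i)} (h : σ.MatchesBox o Φ) {k : J}
    {m : ∀ i : {i // N.Conn i k}, σ.S i} (hm : σ.Possible k m) :
    σ.resp k m (o k) = if ∀ i : {i // N.Conn i k}, m i ∈ Φ i then 1 else 0 := by
  obtain ⟨s, hs, rfl⟩ := hm.exists_extension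
  split_ifs with hΦ
  · exact (h k s hs).2.2 fun i hi => hΦ ⟨i, hi⟩
  · exact (h k s hs).1.resolve_right fun h1 => hΦ fun i => (h k s hs).2.1 h1 i i.2

open Classical in
theorem HasMatchProbs.tsum_box (h : σ.HasMatchProbs p label) (hecs : N.IsECS) {c : Fin C}
    (hc : p c ≠ 0) {Φ : ∀ i, Set (σ.S i)} (hΦ : σ.MatchesBox (fun j => label j c) Φ) (i : I) :
    ∑' y, σ.src i y * (if y ∈ Φ i then 1 else 0) = p c := by
  refine eq_of_reachedProd_eq (q := fun i => ∑' y, σ.src i y * (if y ∈ Φ i then 1 else 0)) hecs hc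
    (p.apply_ne_top c) (fun T => ?_) i
  rw [← matchProb_const, ← h T]
  have h1 : ∀ s : ∀ i, σ.S i, weight σ.src s ≠ 0 →
      ∏ k ∈ T, σ.resp k (fun i => s i) (label k c) =
        ∏ i, if (∃ k ∈ T, N.Conn i k) → s i ∈ Φ i then 1 else 0 := by
    intro s hs
    refine (Finset.prod_congr rfl fun k _ =>
      hΦ.resp_eq (σ.possible_of_weight_ne_zero hs k)).trans ?_
    simp only [Finset.prod_boole, Subtype.forall, Finset.mem_univ, true_imp_iff]
    congr 1
    exact propext ⟨fun h i ⟨k, hk, hi⟩ => h k hk i hi, fun h k hk i hi => h i ⟨k, hk, hi⟩⟩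
  rw [expect_congr σ.src h1, expect_prod σ.src (fun i y =>
    if (∃ k ∈ T, N.Conn i k) → y ∈ Φ i then 1 else 0)]
  refine Finset.prod_congr rfl fun i _ => ?_
  split_ifs with hi
  · simp [hi]
  · simp [hi, PMF.tsum_coe]

theorem HasMatchProbs.exists_box [Fintype J] (h : σ.HasMatchProbs p label) (hecs : N.IsECS)
    (hpfis : N.AdmitsPFIS) {c : Fin C} (hc : p c ≠ 0) :
    ∃ Φ : ∀ i, Set (σ.S i), σ.MatchesBox (fun j => label j c) Φ := by
  classical
  obtain ⟨x, hx01, hx⟩ := hpfis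
  have hx' : ∀ i, ∑ k with N.Conn i k, x k = 1 := fun i => by
    rw [← hx i]
    exact Finset.sum_subtype _ (by simp) _
  have hE1 : ∀ k, expect σ.src (fun s => σ.resp k (fun i => s i) (label k c)) =
      ∏ i, if N.Conn i k then p c else 1 := fun k => by
    have := h {k} fun _ => c
    rw [matchProb_const] at this
    simpa [reachedProd] using this
  refine exists_box_of_finner σ.src (conn := N.Conn) (x := x)
    (f := fun k s => σ.resp k (fun i => s i) (label k c)) (fun k => (hx01 k).1) hx' ?_ ?_ ?_ ?_
    (fun k => (hx01 k).2) ?_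
  · intro k s s' hs
    have : (fun i : {i // N.Conn i k} => s i) = fun i : {i // N.Conn i k} => s' i :=
      funext fun i => hs i i.2
    simp only [this]
  · exact fun k s => PMF.coe_le_one _ _
  · intro k
    rw [hE1]
    refine Finset.prod_ne_zero_iff.2 fun l _ => ?_
    split_ifs <;> simp [hc]
  · have hu := h Finset.univ fun _ => c
    rw [matchProb_const] at hu
    rw [hu]
    simp only [hE1, reachedProd]
    have : ∀ k, (∏ i, if N.Conn i k then p c else 1) ^ x k =
        ∏ i, if N.Conn i k then p c ^ x k else 1 := fun k => by
      rw [← ENNReal.prod_rpow_of_nonneg (hx01 k).1.le]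
      refine Finset.prod_congr rfl fun i _ => ?_
      split_ifs <;> simp
    rw [Finset.prod_congr rfl fun k _ => this k, Finset.prod_comm]
    refine Finset.prod_le_prod' fun i _ => ?_
    rw [← Finset.prod_filter, prod_rpow_eq_rpow_sum (fun k _ => (hx01 k).1.le), hx' i,
      ENNReal.rpow_one, if_pos]
    obtain ⟨j, -, -, hj, -⟩ := hecs i
    exact ⟨j, Finset.mem_univ j, hj⟩
  · intro i
    obtain ⟨j, j', -, hj, hj', hu⟩ := hecs i
    exact ⟨j, j', hj, hj', hu⟩

theorem HasMatchProbs.box_disjoint (h : σ.HasMatchProbs p label) (hecs : N.IsECS)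
    (hp : ∀ c, p c ≠ 0) {Φ : Fin C → ∀ i, Set (σ.S i)}
    (hΦ : ∀ c, σ.MatchesBox (fun j => label j c) (Φ c)) {c c' : Fin C} {i : I} {y : σ.S i}
    (hy : σ.src i y ≠ 0) (hc : y ∈ Φ c i) (hc' : y ∈ Φ c' i) : c = c' := by
  classical
  by_contra hne
  have hz : ∀ c l, ∃ z, σ.src l z ≠ 0 ∧ z ∈ Φ c l := fun c l => by
    by_contra! hcon
    refine hp c ?_
    rw [← h.tsum_box hecs (hp c) (hΦ c) l, ENNReal.tsum_eq_zero]
    intro z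
    by_cases hz : σ.src l z = 0
    · simp [hz]
    · simp [hcon z hz]
  choose z hz0 hzΦ using hz
  obtain ⟨j, j', hjj, hj, hj', hu⟩ := hecs i
  -- With `y` in both sides, `j` would announce `c` and `j'` would announce `c'`; the choices do not
  -- conflict because `i` is their only common source.
  let s : ∀ l, σ.S l :=
    Function.update (fun l => if N.Conn l j then z c l else z c' l) i y
  have hs : weight σ.src s ≠ 0 := by
    refine weight_update_ne_zero _ ((weight_ne_zero_iff _).2 fun l => ?_) hy
    split_ifs <;> exact hz0 _ _
  have h0 := h {j, j'} fun k => if k = j then c else c'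
  rw [matchProb_eq_zero p (i := i) (j := j) (j' := j') (by simp) (by simp) hj hj'
    (by simpa [hjj.symm] using hne), expect_eq_zero_iff] at h0
  have h0 := h0 s hs
  rw [Finset.prod_pair hjj, if_pos rfl, if_neg hjj.symm, (hΦ c j s hs).2.2, (hΦ c' j' s hs).2.2,
    one_mul] at h0
  · exact one_ne_zero h0
  · intro l hl
    by_cases hli : l = i
    · subst hli; simpa [s] using hc'
    · simpa [s, hli, show ¬ N.Conn l j from fun h => hli (hu l h hl)] using hzΦ c' l
  · intro l hl
    by_cases hli : l = i
    · subst hli; simpa [s] using hc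
    · simpa [s, hli, hl] using hzΦ c l

open Classical in
theorem HasMatchProbs.sum_box (h : σ.HasMatchProbs p label) (hecs : N.IsECS)
    (hp : ∀ c, p c ≠ 0) {Φ : Fin C → ∀ i, Set (σ.S i)}
    (hΦ : ∀ c, σ.MatchesBox (fun j => label j c) (Φ c)) {i : I} {y : σ.S i}
    (hy : σ.src i y ≠ 0) : ∑ c, (if y ∈ Φ c i then (1 : ℝ≥0∞) else 0) = 1 := by
  have hle : ∀ y, σ.src i y ≠ 0 → ∑ c, (if y ∈ Φ c i then (1 : ℝ≥0∞) else 0) ≤ 1 := by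
    intro y hy
    rw [Finset.sum_boole]
    norm_cast
    refine Finset.card_le_one.2 fun c hc c' hc' => ?_
    simp only [Finset.mem_filter_univ] at hc hc'
    exact h.box_disjoint hecs hp hΦ hy hc hc'
  -- Sides may overlap at values of probability zero; truncation at 1 makes the bound hold
  -- everywhere.
  have hsum : ∑' y, σ.src i y * min (∑ c, (if y ∈ Φ c i then (1 : ℝ≥0∞) else 0)) 1 = 1 := by
    have : ∀ y, σ.src i y * min (∑ c, (if y ∈ Φ c i then (1 : ℝ≥0∞) else 0)) 1 =
        ∑ c, σ.src i y * (if y ∈ Φ c i then (1 : ℝ≥0∞) else 0) := fun y => by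
      rw [← Finset.mul_sum]
      by_cases hy : σ.src i y = 0
      · simp [hy]
      · rw [min_eq_left (hle y hy)]
    rw [tsum_congr this, Summable.tsum_finsetSum (fun _ _ => ENNReal.summable),
      Finset.sum_congr rfl fun c _ => h.tsum_box hecs (hp c) (hΦ c) i, ← tsum_fintype (L := .unconditional _), p.tsum_coe]
  rw [← min_eq_left (hle y hy)]
  refine eq_of_tsum_mul_le (g := fun _ => 1)
    (f := fun y => min (∑ c, (if y ∈ Φ c i then (1 : ℝ≥0∞) else 0)) 1) (fun y => min_le_right _ _) (σ.src i).apply_ne_top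
    (by rw [hsum]; exact ENNReal.one_ne_top) ?_ hy
  rw [hsum]
  simp [PMF.tsum_coe]

/-- The colour classes of any valid colouring are themselves sides of boxes, whose probabilities are
already determined. -/
theorem HasMatchProbs.map_eq (h : σ.HasMatchProbs p label) (hecs : N.IsECS)
    (hp : ∀ c, p c ≠ 0) {κ : ∀ i, σ.S i → Fin C} (hκ : σ.OutputsMatches label κ) (i : I) :
    (σ.src i).map (κ i) = p := by
  classical
  ext c
  have hbox : σ.MatchesBox (fun j => label j c) fun i => {y | κ i y = c} := fun k s hs => by
    rw [hκ k _ (σ.possible_of_weight_ne_zero hs k) c]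
    split_ifs with hc
    · simpa using hc
    · simpa using hc
  rw [← h.tsum_box hecs (hp c) hbox i, PMF.map_apply]
  refine tsum_congr fun y => ?_
  by_cases hy : κ i y = c
  · simp [hy]
  · simp [hy, Ne.symm hy]

theorem HasMatchProbs.exists_outputsMatches (h : σ.HasMatchProbs p label) (hecs : N.IsECS)
    (hp : ∀ c, p c ≠ 0) {Φ : Fin C → ∀ i, Set (σ.S i)}
    (hΦ : ∀ c, σ.MatchesBox (fun j => label j c) (Φ c)) :
    ∃ κ : ∀ i, σ.S i → Fin C, σ.OutputsMatches label κ := by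
  classical
  -- Values of probability zero receive an arbitrary colour.
  have hex : ∀ i y, ∃ c, σ.src i y ≠ 0 → y ∈ Φ c i := fun i y => by
    by_contra! hcon
    have := h.sum_box hecs hp hΦ (hcon p.support_nonempty.some).1
    simp [fun c => (hcon c).2] at this
  choose κ hκ using hex
  refine ⟨κ, fun j m hm c => ?_⟩
  rw [(hΦ c).resp_eq hm]
  congr 1
  refine propext (forall_congr' fun i => ?_)
  have hi := (PMF.mem_support_iff _ _).1 (hm i)
  exact ⟨fun hc => h.box_disjoint hecs hp hΦ hi (hκ i _ hi) hc, fun hc => hc ▸ hκ i _ hi⟩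

end ClassicalStrategy

end NetCorr

theorem theorem2 {I : Type uu} {J : Type vv} [Fintype I] [Fintype J] [DecidableEq I]
    [DecidableEq J] (N : NetCorr.Network I J) (hECS : N.IsECS) (hPFIS : N.AdmitsPFIS)
    {O : J → Type oo} {C : ℕ} (p : PMF (Fin C)) (hp : ∀ c, 0 < p c)
    (label : ∀ j, Fin C → O j) (hlabel : ∀ j, Function.Injective (label j))
    (P : (∀ j, O j) → ℝ≥0∞)
    (hP : NetCorr.IsCMDistribution.{uu, vv, ww, oo} N p label P)
    (σ : NetCorr.ClassicalStrategy.{uu, vv, ss, oo} N O) (hσ : σ.outcomeProb = P) :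
    (∃ φ : ∀ i, Fin C → σ.S i → ℝ≥0∞,
      (∀ i c s, φ i c s = 0 ∨ φ i c s = 1) ∧
      (∀ j m, σ.Possible j m → ∀ c,
        σ.resp j m (label j c) = ∏ i : {i // N.Conn i j}, φ i c (m i)) ∧
      (∀ i, ∀ s ∈ (σ.src i).support, ∑ c, φ i c s = 1) ∧
      (∀ i c, ∑' s, σ.src i s * φ i c s = p c)) ∧
    σ.IsColorMatching p label ∧
    (∀ κ : ∀ i, σ.S i → Fin C, σ.OutputsMatches label κ →
      ∀ i, (σ.src i).map (κ i) = p) := by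
  classical
  have hp0 : ∀ c, p c ≠ 0 := fun c => (hp c).ne'
  have hconn : ∀ i, ∃ j, N.Conn i j := fun i =>
    let ⟨j, _, _, hj, _⟩ := hECS i; ⟨j, hj⟩
  have hM : σ.HasMatchProbs p label := fun T c => by
    rw [← hP.marginal_eq_matchProb hconn T c, ← hσ, σ.marginal_outcomeProb]
  choose Φ hΦ using fun c => hM.exists_box hECS hPFIS (hp0 c)
  refine ⟨⟨fun i c s => if s ∈ Φ c i then 1 else 0, fun i c s => ?_, fun j m hm c => ?_,
    fun i s hs => hM.sum_box hECS hp0 hΦ ((PMF.mem_support_iff _ _).1 hs),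
    fun i c => hM.tsum_box hECS (hp0 c) (hΦ c) i⟩, ?_, fun κ hκ => hM.map_eq hECS hp0 hκ⟩
  · beta_reduce
    split_ifs <;> simp
  · rw [(hΦ c).resp_eq hm]
    simp [Finset.prod_boole]
  · obtain ⟨κ, hκ⟩ := hM.exists_outputsMatches hECS hp0 hΦ
    exact ⟨κ, hM.map_eq hECS hp0 hκ, hκ⟩
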